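/- Theorem (Liouville). Let $u\in H^1_{\mathrm{loc}}(\mathbb R^n)$ be an entire weakly harmonic real-valued function, that is, $\int_{\mathbb R^n}\nabla u\cdot\nabla\phi\,dx=0$ for every $\phi\in C_c^\infty(\mathbb R^n)$, and suppose that there are constants $C>0$ and $\gamma\ge 0$ with $|u(x)|\le C(1+|x|)^\gamma$ for almost every $x\in\mathbb R^n$. Then $u$ coincides almost everywhere with a polynomial of degree at most $\lfloor\gamma\rfloor=\max\{k\in\mathbb Z: k\le\gamma\}$. The same conclusion holds, under the same growth condition, if instead $u\in H^1_{\mathrm{loc}}(\mathbb R^n)$ is an entire weak solution of $-\mathrm{div}(A\nabla u)=0$, that is, $\int_{\mathbb R^n}A\nabla u\cdot\nabla\phi\,dx=0$ for every $\phi\in C_c^\infty(\mathbb R^n)$, where $A\in\mathbb R^{n\times n}$ is a constant, not necessarily symmetric, uniformly elliptic matrix: there are constants $0<\lambda\le\Lambda$ with $\lambda|\xi|^2\le A\xi\cdot\xi\le\Lambda|\xi|^2$ for all $\xi\in\mathbb R^n$. -/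

import Mathlib

open MeasureTheory
open scoped ContDiff

/-- A test function, i.e. an element of `C_c^∞(ℝⁿ)`. -/
def IsTestFunction {n : ℕ} (φ : EuclideanSpace ℝ (Fin n) → ℝ) : Prop :=
  ContDiff ℝ ∞ φ ∧ HasCompactSupport φ

/-- The classical partial derivative `∂ᵢφ(x)`. -/
noncomputable def partialDeriv {n : ℕ} (i : Fin n) (φ : EuclideanSpace ℝ (Fin n) → ℝ)
    (x : EuclideanSpace ℝ (Fin n)) : ℝ :=
  fderiv ℝ φ x (EuclideanSpace.single i 1)

/-- `g` is a weak gradient of `u` on `ℝⁿ`: both are locally integrable and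
`∫ u ∂ᵢφ = - ∫ gᵢ φ` for every test function `φ` and every index `i`. -/
structure HasWeakGradient {n : ℕ} (u : EuclideanSpace ℝ (Fin n) → ℝ)
    (g : EuclideanSpace ℝ (Fin n) → EuclideanSpace ℝ (Fin n)) : Prop where
  locallyIntegrable : LocallyIntegrable u volume
  locallyIntegrable_grad : LocallyIntegrable g volume
  integral_eq : ∀ φ : EuclideanSpace ℝ (Fin n) → ℝ, IsTestFunction φ → ∀ i : Fin n,
    ∫ x, u x * partialDeriv i φ x = - ∫ x, g x i * φ x

/-- `f ∈ L²_loc(ℝⁿ)`: `f` is square integrable on every ball `B_R`. -/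
def MemL2Loc {n : ℕ} {F : Type*} [NormedAddCommGroup F]
    (f : EuclideanSpace ℝ (Fin n) → F) : Prop :=
  ∀ R : ℝ, 0 < R → MemLp f 2 (volume.restrict (Metric.ball 0 R))

/-- `u ∈ H¹_loc(ℝⁿ)`: `u` is in `L²_loc` and has a weak gradient in `L²_loc`. -/
def MemH1Loc {n : ℕ} (u : EuclideanSpace ℝ (Fin n) → ℝ) : Prop :=
  MemL2Loc u ∧ ∃ g : EuclideanSpace ℝ (Fin n) → EuclideanSpace ℝ (Fin n),
    HasWeakGradient u g ∧ MemL2Loc g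

/-- `u` is an entire (weakly) harmonic function: `u ∈ H¹_loc(ℝⁿ)` and `∫ ∇u · ∇φ = 0` for every
test function `φ`. The weak gradient is unique up to null sets, so quantifying over all of them
is the same as choosing one. -/
def IsEntireHarmonic {n : ℕ} (u : EuclideanSpace ℝ (Fin n) → ℝ) : Prop :=
  MemH1Loc u ∧
    ∀ g : EuclideanSpace ℝ (Fin n) → EuclideanSpace ℝ (Fin n), HasWeakGradient u g →
      ∀ φ : EuclideanSpace ℝ (Fin n) → ℝ, IsTestFunction φ →
        ∫ x, ∑ i, g x i * partialDeriv i φ x = 0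

/-- `u` is an entire weak solution of `-div(A∇u) = 0` for the constant matrix `A`:
`u ∈ H¹_loc(ℝⁿ)` and `∫ A∇u · ∇φ = 0` for every test function `φ`. -/
def IsEntireSolution {n : ℕ} (A : Matrix (Fin n) (Fin n) ℝ)
    (u : EuclideanSpace ℝ (Fin n) → ℝ) : Prop :=
  MemH1Loc u ∧
    ∀ g : EuclideanSpace ℝ (Fin n) → EuclideanSpace ℝ (Fin n), HasWeakGradient u g →
      ∀ φ : EuclideanSpace ℝ (Fin n) → ℝ, IsTestFunction φ →
        ∫ x, ∑ i, (∑ j, A i j * g x j) * partialDeriv i φ x = 0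

/-- The constant matrix `A`, not necessarily symmetric, is uniformly elliptic:
`a |ξ|² ≤ Aξ · ξ ≤ b |ξ|²` for all `ξ`, for some constants `0 < a ≤ b`. -/
def IsUniformlyElliptic {n : ℕ} (A : Matrix (Fin n) (Fin n) ℝ) : Prop :=
  ∃ a b : ℝ, 0 < a ∧ a ≤ b ∧ ∀ ξ : EuclideanSpace ℝ (Fin n),
    a * ‖ξ‖ ^ 2 ≤ ∑ i, (∑ j, A i j * ξ j) * ξ i ∧
      ∑ i, (∑ j, A i j * ξ j) * ξ i ≤ b * ‖ξ‖ ^ 2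

/-!
Using `∂ᵢφ` as test function in the definition of the weak gradient shows that a weak solution
`u` satisfies `∫ u Lφ = 0` for every test function `φ`, where `Lφ = ∑ᵢⱼ Aᵢⱼ ∂ⱼ∂ᵢφ`
(`IsEntireSolution.integral_mul_divGrad_eq_zero`). Hence every mollification `v = u ⋆ ρ` is a smooth
solution of `Lv = 0`, and it inherits the growth bound of `u`.

For smooth solutions, `L(v²) = 2 A∇v · ∇v`, so integrating against a cutoff gives the Caccioppoli
inequality `exists_caccioppoli`. It says that if `∫_{B_R} v² = O(Rˢ)`, then
`∫_{B_R} (∂ₖv)² = O(Rˢ⁻²)`. Since `∂ₖv` is again a solution, this can be iterated: derivatives of `v`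
of high order have square integral `O(R^σ)` over `B_R` with `σ < 0`, so they vanish, and `v` is a polynomial
(`HasSqGrowth.exists_eval_eq`). The growth bound then forces its degree to be at most `⌊γ⌋`
(`MvPolynomial.totalDegree_le_of_growth`).

Finally, `u` is almost everywhere the limit of mollifications, all of them polynomials of degree at
most `⌊γ⌋`. These form a finite-dimensional space, closed under pointwise convergence on the set
where the mollifications converge (`MvPolynomial.exists_eval_eq_of_tendsto`), so `u` is such a
polynomial almost everywhere. The harmonic case is `A = 1`.
-/

/-! ### Calculus of partial derivatives -/

section PartialDeriv

variable {n : ℕ} {f g : EuclideanSpace ℝ (Fin n) → ℝ}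

theorem ContDiff.partialDeriv (hf : ContDiff ℝ ∞ f) (i : Fin n) :
    ContDiff ℝ ∞ (partialDeriv i f) := by
  unfold _root_.partialDeriv
  exact (hf.fderiv_right (m := ∞) (by simp)).clm_apply contDiff_const

theorem HasCompactSupport.partialDeriv (hf : HasCompactSupport f) (i : Fin n) :
    HasCompactSupport (partialDeriv i f) :=
  hf.fderiv_apply (𝕜 := ℝ) _

theorem IsTestFunction.partialDeriv (hf : IsTestFunction f) (i : Fin n) :
    IsTestFunction (partialDeriv i f) :=
  ⟨hf.1.partialDeriv i, hf.2.partialDeriv i⟩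

theorem tsupport_partialDeriv_subset (i : Fin n) :
    tsupport (partialDeriv i f) ⊆ tsupport f :=
  tsupport_fderiv_apply_subset ℝ _

theorem partialDeriv_comm (hf : ContDiff ℝ ∞ f) (i j : Fin n) :
    partialDeriv i (partialDeriv j f) = partialDeriv j (partialDeriv i f) := by
  have hd : Differentiable ℝ (fderiv ℝ f) :=
    (hf.fderiv_right (m := ∞) (by simp)).differentiable (by simp)
  have key (i j : Fin n) (x) : partialDeriv i (partialDeriv j f) x =
      fderiv ℝ (fderiv ℝ f) x (EuclideanSpace.single i 1) (EuclideanSpace.single j 1) := by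
    unfold partialDeriv
    rw [fderiv_clm_apply (hd x) (differentiableAt_const _)]
    simp
  ext x
  rw [key, key]
  exact (hf.contDiffAt.isSymmSndFDerivAt
    (by simpa using WithTop.coe_le_coe.2 (le_top : (2 : ℕ∞) ≤ ⊤))) _ _

theorem partialDeriv_mul (hf : ContDiff ℝ ∞ f) (hg : ContDiff ℝ ∞ g) (i : Fin n) :
    partialDeriv i (fun x => f x * g x) =
      fun x => f x * partialDeriv i g x + partialDeriv i f x * g x := by
  ext x
  unfold partialDeriv
  rw [fderiv_fun_mul (hf.differentiable (by simp) x) (hg.differentiable (by simp) x)]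
  simp [mul_comm]

theorem partialDeriv_add (hf : ContDiff ℝ ∞ f) (hg : ContDiff ℝ ∞ g) (i : Fin n) :
    partialDeriv i (fun x => f x + g x) = fun x => partialDeriv i f x + partialDeriv i g x := by
  ext x
  unfold partialDeriv
  rw [fderiv_fun_add (hf.differentiable (by simp) x) (hg.differentiable (by simp) x)]
  simp

theorem partialDeriv_const_mul (hf : ContDiff ℝ ∞ f) (c : ℝ) (i : Fin n) :
    partialDeriv i (fun x => c * f x) = fun x => c * partialDeriv i f x := by
  ext x
  unfold partialDeriv
  rw [fderiv_const_mul (hf.differentiable (by simp) x)]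
  simp

theorem partialDeriv_sum {ι : Type*} (s : Finset ι) {F : ι → EuclideanSpace ℝ (Fin n) → ℝ}
    (hF : ∀ k ∈ s, ContDiff ℝ ∞ (F k)) (i : Fin n) :
    partialDeriv i (fun x => ∑ k ∈ s, F k x) = fun x => ∑ k ∈ s, partialDeriv i (F k) x := by
  ext x
  unfold partialDeriv
  rw [fderiv_fun_sum fun k hk => (hF k hk).differentiable (by simp) x]
  simp

theorem partialDeriv_const_sub_comp (hf : ContDiff ℝ ∞ f) (x : EuclideanSpace ℝ (Fin n))
    (i : Fin n) :
    partialDeriv i (fun t => f (x - t)) = fun t => -partialDeriv i f (x - t) := by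
  ext t
  unfold partialDeriv
  have h1 : HasFDerivAt (fun t => f (x - t)) _ t :=
    (hf.differentiable (by simp) (x - t)).hasFDerivAt.comp t ((hasFDerivAt_id t).const_sub x)
  rw [h1.fderiv]
  simp

theorem partialDeriv_smul_comp (hf : ContDiff ℝ ∞ f) (c : ℝ) (i : Fin n) :
    partialDeriv i (fun t => f (c • t)) = fun t => c * partialDeriv i f (c • t) := by
  ext t
  unfold partialDeriv
  have h1 : HasFDerivAt (fun t => f (c • t)) _ t :=
    (hf.differentiable (by simp) (c • t)).hasFDerivAt.comp t ((hasFDerivAt_id t).const_smul c)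
  rw [h1.fderiv]
  simp

theorem integral_mul_partialDeriv (hf : ContDiff ℝ ∞ f) (hg : IsTestFunction g) (i : Fin n) :
    ∫ x, f x * partialDeriv i g x = -∫ x, partialDeriv i f x * g x := by
  refine integral_mul_fderiv_eq_neg_fderiv_mul_of_integrable ?_ ?_ ?_
    (fun x _ => hf.differentiable (by simp) x) (fun x _ => hg.1.differentiable (by simp) x)
  · exact ((hf.partialDeriv i).continuous.mul hg.1.continuous).integrable_of_hasCompactSupport
      hg.2.mul_left
  · exact (hf.continuous.mul (hg.1.partialDeriv i).continuous).integrable_of_hasCompactSupport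
      (hg.2.partialDeriv i).mul_left
  · exact (hf.continuous.mul hg.1.continuous).integrable_of_hasCompactSupport hg.2.mul_left

end PartialDeriv

/-! ### The constant-coefficient operator and the Caccioppoli inequality -/

section Caccioppoli

variable {n : ℕ} {A : Matrix (Fin n) (Fin n) ℝ} {v f φ : EuclideanSpace ℝ (Fin n) → ℝ}

/-- The operator `φ ↦ div (Aᵀ∇φ) = ∑ᵢⱼ Aᵢⱼ ∂ⱼ∂ᵢφ`. By symmetry of second derivatives it agrees
with `div (A∇φ)` on smooth functions. -/
noncomputable def divGrad (A : Matrix (Fin n) (Fin n) ℝ) (φ : EuclideanSpace ℝ (Fin n) → ℝ)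
    (x : EuclideanSpace ℝ (Fin n)) : ℝ :=
  ∑ i, ∑ j, A i j * partialDeriv j (partialDeriv i φ) x

theorem ContDiff.divGrad (hf : ContDiff ℝ ∞ f) : ContDiff ℝ ∞ (divGrad A f) := by
  unfold _root_.divGrad
  exact ContDiff.sum fun i _ => ContDiff.sum fun j _ =>
    contDiff_const.mul ((hf.partialDeriv i).partialDeriv j)

theorem tsupport_divGrad_subset : tsupport (divGrad A f) ⊆ tsupport f := by
  refine closure_minimal (fun x hx => ?_) (isClosed_tsupport f)
  by_contra hxf
  refine hx (Finset.sum_eq_zero fun i _ => Finset.sum_eq_zero fun j _ => ?_)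
  have : x ∉ tsupport (partialDeriv j (partialDeriv i f)) := fun h =>
    hxf (tsupport_partialDeriv_subset i (tsupport_partialDeriv_subset j h))
  rw [image_eq_zero_of_notMem_tsupport this, mul_zero]

theorem IsTestFunction.divGrad (hf : IsTestFunction f) : IsTestFunction (divGrad A f) :=
  ⟨hf.1.divGrad, hf.2.mono' ((subset_tsupport _).trans tsupport_divGrad_subset)⟩

theorem divGrad_partialDeriv (hv : ContDiff ℝ ∞ v) (k : Fin n) :
    divGrad A (partialDeriv k v) = partialDeriv k (divGrad A v) := by
  have h (i j : Fin n) : ContDiff ℝ ∞ (fun x => A i j * partialDeriv j (partialDeriv i v) x) :=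
    contDiff_const.mul ((hv.partialDeriv i).partialDeriv j)
  unfold divGrad
  rw [partialDeriv_sum _ fun i _ => ContDiff.sum fun j _ => h i j]
  ext x
  refine Finset.sum_congr rfl fun i _ => ?_
  rw [partialDeriv_sum _ fun j _ => h i j]
  refine Finset.sum_congr rfl fun j _ => ?_
  rw [partialDeriv_const_mul ((hv.partialDeriv i).partialDeriv j), partialDeriv_comm hv i k,
    partialDeriv_comm (hv.partialDeriv i) j k]

/-- Second-order product rule for `v²`. For a solution the first term vanishes, and ellipticity
bounds the second from below by `|∇v|²`. -/
theorem divGrad_sq (hv : ContDiff ℝ ∞ v) (x : EuclideanSpace ℝ (Fin n)) :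
    divGrad A (fun y => v y * v y) x =
      2 * (v x * divGrad A v x) +
        2 * ∑ i, (∑ j, A i j * partialDeriv j v x) * partialDeriv i v x := by
  have h (i j : Fin n) : partialDeriv j (partialDeriv i fun y => v y * v y) x =
      2 * (v x * partialDeriv j (partialDeriv i v) x) +
        2 * (partialDeriv j v x * partialDeriv i v x) := by
    have hi := hv.partialDeriv i
    rw [partialDeriv_mul hv hv, partialDeriv_add (hv.mul hi) (hi.mul hv),
      partialDeriv_mul hv hi, partialDeriv_mul hi hv]
    ring
  simp only [divGrad, h, Finset.mul_sum, Finset.sum_mul, ← Finset.sum_add_distrib]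
  refine Finset.sum_congr rfl fun i _ => Finset.sum_congr rfl fun j _ => ?_
  ring

theorem integral_sum_sum_const_mul (A : Matrix (Fin n) (Fin n) ℝ)
    {F : Fin n → Fin n → EuclideanSpace ℝ (Fin n) → ℝ} (hF : ∀ i j, Integrable (F i j)) :
    ∫ x, ∑ i, ∑ j, A i j * F i j x = ∑ i, ∑ j, A i j * ∫ x, F i j x := by
  rw [integral_finsetSum _ fun i _ =>
    integrable_finsetSum _ fun j _ => (hF i j).const_mul (A i j)]
  refine Finset.sum_congr rfl fun i _ => ?_
  rw [integral_finsetSum _ fun j _ => (hF i j).const_mul (A i j)]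
  simp only [integral_const_mul]

/-- Moving both derivatives of `divGrad A` from one factor to the other leaves the matrix `A`
unchanged rather than transposed, because partial derivatives commute. -/
theorem integral_mul_divGrad (hf : ContDiff ℝ ∞ f) (hφ : IsTestFunction φ) :
    ∫ x, f x * divGrad A φ x = ∫ x, divGrad A f x * φ x := by
  have h1 (i j : Fin n) : Integrable fun x => f x * partialDeriv j (partialDeriv i φ) x :=
    (hf.continuous.mul
      ((hφ.1.partialDeriv i).partialDeriv j).continuous).integrable_of_hasCompactSupport
      ((hφ.partialDeriv i).partialDeriv j).2.mul_left
  have h2 (i j : Fin n) : Integrable fun x => partialDeriv j (partialDeriv i f) x * φ x :=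
    (((hf.partialDeriv i).partialDeriv j).continuous.mul
      hφ.1.continuous).integrable_of_hasCompactSupport hφ.2.mul_left
  simp only [divGrad, Finset.mul_sum, Finset.sum_mul, mul_left_comm (f _), mul_assoc]
  rw [integral_sum_sum_const_mul A h1, integral_sum_sum_const_mul A h2]
  refine Finset.sum_congr rfl fun i _ => Finset.sum_congr rfl fun j _ => ?_
  rw [integral_mul_partialDeriv hf (hφ.partialDeriv i),
    integral_mul_partialDeriv (hf.partialDeriv j) hφ, neg_neg, partialDeriv_comm hf]

theorem divGrad_smul_comp (hf : ContDiff ℝ ∞ f) (c : ℝ) (x : EuclideanSpace ℝ (Fin n)) :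
    divGrad A (fun t => f (c • t)) x = c ^ 2 * divGrad A f (c • x) := by
  unfold divGrad
  have (i j : Fin n) : partialDeriv j (partialDeriv i fun t => f (c • t)) x =
      c ^ 2 * partialDeriv j (partialDeriv i f) (c • x) := by
    have hc : ContDiff ℝ ∞ (fun t : EuclideanSpace ℝ (Fin n) => partialDeriv i f (c • t)) :=
      (hf.partialDeriv i).comp (contDiff_const_smul c)
    rw [partialDeriv_smul_comp hf, partialDeriv_const_mul hc,
      partialDeriv_smul_comp (hf.partialDeriv i)]
    ring
  simp only [this, Finset.mul_sum]
  exact Finset.sum_congr rfl fun i _ => Finset.sum_congr rfl fun j _ => by ring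

theorem divGrad_const_sub_comp (hf : ContDiff ℝ ∞ f) (x t : EuclideanSpace ℝ (Fin n)) :
    divGrad A (fun t => f (x - t)) t = divGrad A f (x - t) := by
  unfold divGrad
  refine Finset.sum_congr rfl fun i _ => Finset.sum_congr rfl fun j _ => ?_
  have hi : ContDiff ℝ ∞ (fun t => partialDeriv i f (x - t)) :=
    (hf.partialDeriv i).comp (contDiff_const.sub contDiff_id)
  have := partialDeriv_const_mul hi (-1) j
  simp only [neg_one_mul] at this
  rw [partialDeriv_const_sub_comp hf, this, partialDeriv_const_sub_comp (hf.partialDeriv i)]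
  simp only [neg_neg]

/-- **Caccioppoli inequality**: the energy of a smooth solution on a ball of radius `R` is
controlled by `R⁻²` times the square of its `L²` norm on the ball of radius `2R`. It holds because
`div (A∇(v²)) = 2 A∇v · ∇v` for solutions, so that testing with a cutoff `φ` and moving both
derivatives onto `φ` bounds `∫ φ A∇v · ∇v`. -/
theorem exists_caccioppoli (A : Matrix (Fin n) (Fin n) ℝ) {a : ℝ} (ha : 0 < a)
    (hA : ∀ ξ : EuclideanSpace ℝ (Fin n), a * ‖ξ‖ ^ 2 ≤ ∑ i, (∑ j, A i j * ξ j) * ξ i) :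
    ∃ K : ℝ, 0 ≤ K ∧ ∀ v : EuclideanSpace ℝ (Fin n) → ℝ, ContDiff ℝ ∞ v →
      (∀ x, divGrad A v x = 0) → ∀ (k : Fin n) (R : ℝ), 0 < R →
        ∫ x in Metric.closedBall 0 R, partialDeriv k v x ^ 2 ≤
          K * R⁻¹ ^ 2 * ∫ x in Metric.closedBall 0 (2 * R), v x ^ 2 := by
  let χ : ContDiffBump (0 : EuclideanSpace ℝ (Fin n)) := ⟨1, 2, one_pos, one_lt_two⟩
  have hχ : IsTestFunction (χ : EuclideanSpace ℝ (Fin n) → ℝ) :=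
    ⟨χ.contDiff, χ.hasCompactSupport⟩
  obtain ⟨M, hM⟩ := hχ.divGrad (A := A).2.exists_bound_of_continuous hχ.divGrad.1.continuous
  have hM0 : 0 ≤ M := (norm_nonneg _).trans (hM 0)
  refine ⟨M / (2 * a), by positivity, fun v hv hsol k R hR => ?_⟩
  set φ : EuclideanSpace ℝ (Fin n) → ℝ := fun x => χ (R⁻¹ • x) with hφdef
  have hsmul : ContDiff ℝ ∞ (fun x : EuclideanSpace ℝ (Fin n) => R⁻¹ • x) :=
    contDiff_const_smul _
  have hφsupp : ∀ x ∉ Metric.closedBall (0 : EuclideanSpace ℝ (Fin n)) (2 * R), φ x = 0 := by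
    intro x hx
    refine χ.zero_of_le_dist ?_
    have : 2 * R ≤ ‖x‖ := by simpa using (not_le.1 (by simpa using hx)).le
    rw [dist_zero_right, norm_smul, norm_inv, Real.norm_of_nonneg hR.le, inv_mul_eq_div,
      le_div_iff₀ hR]
    exact this
  have hφ : IsTestFunction φ :=
    ⟨χ.contDiff.comp hsmul, HasCompactSupport.intro (isCompact_closedBall _ _) hφsupp⟩
  have hφ1 : ∀ x ∈ Metric.closedBall (0 : EuclideanSpace ℝ (Fin n)) R, φ x = 1 := by
    intro x hx
    refine χ.one_of_mem_closedBall ?_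
    rw [mem_closedBall_zero_iff] at hx ⊢
    rw [norm_smul, norm_inv, Real.norm_of_nonneg hR.le, inv_mul_eq_div]
    exact (div_le_one hR).2 hx
  have hφ0 : ∀ x, 0 ≤ φ x := fun x => χ.nonneg
  have hvv : ContDiff ℝ ∞ (fun y => v y * v y) := hv.mul hv
  have hk := (hv.partialDeriv k).continuous
  have hint : Integrable fun x => partialDeriv k v x ^ 2 * φ x :=
    ((hk.pow 2).mul hφ.1.continuous).integrable_of_hasCompactSupport hφ.2.mul_left
  have step1 : ∫ x in Metric.closedBall 0 R, partialDeriv k v x ^ 2 ≤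
      ∫ x, partialDeriv k v x ^ 2 * φ x := by
    calc _ = ∫ x in Metric.closedBall 0 R, partialDeriv k v x ^ 2 * φ x :=
          setIntegral_congr_fun measurableSet_closedBall fun x hx => by simp [hφ1 x hx]
      _ ≤ _ := setIntegral_le_integral hint
          (.of_forall fun x => mul_nonneg (sq_nonneg _) (hφ0 x))
  -- By ellipticity, `L(v²) = 2 A∇v · ∇v ≥ 2a |∇v|²`.
  have step2 : 2 * a * ∫ x, partialDeriv k v x ^ 2 * φ x ≤
      ∫ x, divGrad A (fun y => v y * v y) x * φ x := by
    rw [← integral_const_mul]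
    refine integral_mono (hint.const_mul _)
      ((hvv.divGrad.continuous.mul hφ.1.continuous).integrable_of_hasCompactSupport
        hφ.2.mul_left) fun x => ?_
    have hE := hA (WithLp.toLp 2 fun i => partialDeriv i v x)
    have hk2 : partialDeriv k v x ^ 2 ≤
        ‖(WithLp.toLp 2 fun i => partialDeriv i v x : EuclideanSpace ℝ (Fin n))‖ ^ 2 := by
      rw [EuclideanSpace.real_norm_sq_eq]
      exact Finset.single_le_sum (f := fun i => partialDeriv i v x ^ 2)
        (fun i _ => sq_nonneg _) (Finset.mem_univ k)
    have h3 : 2 * a * partialDeriv k v x ^ 2 ≤ divGrad A (fun y => v y * v y) x := by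
      rw [divGrad_sq hv, hsol]
      have := mul_le_mul_of_nonneg_left hk2 ha.le
      simp only at hE
      linarith
    have := mul_le_mul_of_nonneg_right h3 (hφ0 x)
    simpa [mul_assoc] using this
  -- The factor `R⁻²` comes from the second derivatives of the rescaled cutoff.
  have step3 : ∫ x, divGrad A (fun y => v y * v y) x * φ x ≤
      M * R⁻¹ ^ 2 * ∫ x in Metric.closedBall 0 (2 * R), v x ^ 2 := by
    rw [← integral_mul_divGrad hvv hφ, ← integral_const_mul]
    have hs : ∀ x ∉ Metric.closedBall (0 : EuclideanSpace ℝ (Fin n)) (2 * R),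
        v x * v x * divGrad A φ x = 0 := by
      intro x hx
      rw [image_eq_zero_of_notMem_tsupport (f := divGrad A φ), mul_zero]
      refine fun h => hx (closure_minimal (fun y hy => ?_) Metric.isClosed_closedBall
        (tsupport_divGrad_subset h))
      by_contra hy'
      exact hy (hφsupp y hy')
    rw [← setIntegral_eq_integral_of_forall_compl_eq_zero hs]
    have hc1 : Continuous fun x => v x * v x * divGrad A φ x :=
      hvv.continuous.mul hφ.1.divGrad.continuous
    have hc2 : Continuous fun x => M * R⁻¹ ^ 2 * v x ^ 2 :=
      continuous_const.mul (hv.continuous.pow 2)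
    refine setIntegral_mono (hc1.continuousOn.integrableOn_compact (isCompact_closedBall _ _))
      (hc2.continuousOn.integrableOn_compact (isCompact_closedBall _ _)) fun x => ?_
    have h1 : divGrad A φ x ≤ M * R⁻¹ ^ 2 := by
      rw [hφdef, divGrad_smul_comp χ.contDiff, mul_comm]
      exact mul_le_mul_of_nonneg_right ((le_abs_self _).trans (hM _)) (sq_nonneg _)
    have := mul_le_mul_of_nonneg_left h1 (mul_self_nonneg (v x))
    simp only
    linarith
  have h4 := step2.trans step3
  have h5 := mul_le_mul_of_nonneg_left step1 (by positivity : 0 ≤ 2 * a)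
  rw [div_mul_eq_mul_div, div_mul_eq_mul_div, le_div_iff₀ (by positivity), mul_comm]
  exact h5.trans h4

end Caccioppoli

/-! ### Polynomials -/

section Polynomials

open Filter Topology

variable {n : ℕ}

theorem MvPolynomial.eval_smul_monomial {σ : Type*} (s : σ →₀ ℕ) (c t : ℝ) (x : σ → ℝ) :
    eval (t • x) (monomial s c) = t ^ s.degree * eval x (monomial s c) := by
  simp only [eval_monomial, Finsupp.prod, Pi.smul_apply, smul_eq_mul, mul_pow,
    Finset.prod_mul_distrib, Finset.prod_pow_eq_pow_sum, Finsupp.degree_apply]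
  ring

theorem MvPolynomial.IsHomogeneous.eval_smul {σ : Type*} {p : MvPolynomial σ ℝ} {d : ℕ}
    (hp : p.IsHomogeneous d) (t : ℝ) (x : σ → ℝ) : eval (t • x) p = t ^ d * eval x p := by
  rw [p.as_sum, map_sum, map_sum, Finset.mul_sum]
  refine Finset.sum_congr rfl fun s hs => ?_
  have hsd : s.degree = d := by
    by_contra hne
    exact mem_support_iff.1 hs (hp.coeff_eq_zero hne)
  rw [eval_smul_monomial, hsd]

/-- Along every ray through the origin, a polynomial `p` has an antiderivative of the form
`t ↦ t q(tx)` with `q` a polynomial not depending on the ray. -/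
theorem MvPolynomial.exists_hasDerivAt_mul_eval {σ : Type*} (p : MvPolynomial σ ℝ) :
    ∃ q : MvPolynomial σ ℝ, ∀ (x : σ → ℝ) (t : ℝ),
      HasDerivAt (fun t => t * eval (t • x) q) (eval (t • x) p) t := by
  induction p using MvPolynomial.induction_on' with
  | monomial s c =>
    refine ⟨monomial s (c / (s.degree + 1)), fun x t => ?_⟩
    simp only [eval_smul_monomial, ← mul_assoc, ← pow_succ']
    refine ((hasDerivAt_pow (s.degree + 1) t).mul_const _).congr_deriv ?_
    have : (s.degree + 1 : ℝ) ≠ 0 := by positivity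
    simp only [eval_monomial, Nat.add_sub_cancel, Nat.cast_add, Nat.cast_one]
    field_simp
  | add p p' hp hp' =>
    obtain ⟨q, hq⟩ := hp
    obtain ⟨q', hq'⟩ := hp'
    refine ⟨q + q', fun x t => ?_⟩
    simpa [mul_add] using (hq x t).fun_add (hq' x t)

/-- A function whose partial derivatives are polynomials is a polynomial: integrate
`∑ᵢ xᵢ ∂ᵢv` along the rays through the origin. -/
theorem exists_eval_eq_of_partialDeriv {v : EuclideanSpace ℝ (Fin n) → ℝ}
    (hv : ContDiff ℝ ∞ v)
    (h : ∀ i, ∃ p : MvPolynomial (Fin n) ℝ, ∀ x : EuclideanSpace ℝ (Fin n),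
      partialDeriv i v x = MvPolynomial.eval (fun i => x i) p) :
    ∃ p : MvPolynomial (Fin n) ℝ, ∀ x : EuclideanSpace ℝ (Fin n),
      v x = MvPolynomial.eval (fun i => x i) p := by
  choose p hp using h
  choose q hq using fun i => (p i).exists_hasDerivAt_mul_eval
  refine ⟨MvPolynomial.C (v 0) + ∑ i, MvPolynomial.X i * q i, fun x => ?_⟩
  have hray (t : ℝ) : HasDerivAt (fun t : ℝ => v (t • x))
      (∑ i, x i * MvPolynomial.eval (t • fun i => x i) (p i)) t := by
    have h1 : HasDerivAt (fun t : ℝ => v (t • x)) (fderiv ℝ v (t • x) ((1 : ℝ) • x)) t :=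
      (hv.differentiable (by simp) (t • x)).hasFDerivAt.comp_hasDerivAt t
        ((hasDerivAt_id t).smul_const x)
    convert h1 using 1
    conv_rhs => rw [one_smul, ← (EuclideanSpace.basisFun (Fin n) ℝ).sum_repr x, map_sum]
    refine Finset.sum_congr rfl fun i _ => ?_
    have h2 : partialDeriv i v (t • x) = _ := hp i (t • x)
    rw [map_smul, EuclideanSpace.basisFun_apply, EuclideanSpace.basisFun_repr, smul_eq_mul,
      (EuclideanSpace.basisFun (Fin n) ℝ).sum_repr x]
    exact congrArg (x i * ·) h2.symm
  -- Compare `v` with the candidate polynomial at the two ends `t = 0, 1` of the ray.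
  have hw (t : ℝ) : HasDerivAt (fun t : ℝ => v (t • x) -
      ∑ i, x i * (t * MvPolynomial.eval (t • fun i => x i) (q i))) 0 t := by
    convert! (hray t).sub (HasDerivAt.fun_sum fun i _ => (hq i (fun i => x i) t).const_mul (x i))
      using 1
    simp
  have hconst := is_const_of_deriv_eq_zero (fun t => (hw t).differentiableAt)
    (fun t => (hw t).deriv) 1 0
  simp only [one_smul, zero_smul, one_mul, zero_mul, mul_zero, Finset.sum_const_zero,
    sub_zero] at hconst
  simp only [map_add, map_sum, map_mul, MvPolynomial.eval_C, MvPolynomial.eval_X]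
  linarith

/-- A polynomial of growth at most `|x|^γ` has degree at most `γ`, as one sees on a line through the
origin on which the top homogeneous component does not vanish. -/
theorem MvPolynomial.totalDegree_le_of_growth (p : MvPolynomial (Fin n) ℝ) {C γ : ℝ}
    (hγ : 0 ≤ γ)
    (h : ∀ x : EuclideanSpace ℝ (Fin n), |eval (fun i => x i) p| ≤ C * (1 + ‖x‖) ^ γ) :
    (p.totalDegree : ℝ) ≤ γ := by
  by_contra! hlt
  set d := p.totalDegree with hd
  have hp : homogeneousComponent d p ≠ 0 := by
    have hp0 : p ≠ 0 := by
      rintro rfl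
      simp only [totalDegree_zero] at hd
      rw [hd] at hlt
      exact absurd hlt (by simpa using hγ)
    obtain ⟨s, hs, hsd⟩ := p.support.exists_mem_eq_sup (support_nonempty.2 hp0)
      fun s => s.sum fun _ e => e
    intro h0
    have hc := congrArg (coeff s) h0
    rw [coeff_homogeneousComponent, if_pos, coeff_zero] at hc
    · exact mem_support_iff.1 hs hc
    · exact hsd.symm
  obtain ⟨x, hx⟩ : ∃ x, eval x (homogeneousComponent d p) ≠ 0 := by
    by_contra! hall
    exact hp (funext fun x => by simpa using hall x)
  -- The restriction of `p` to the line through `x` is a polynomial with leading coefficient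
  -- the value at `x` of the top homogeneous component.
  set c : ℕ → ℝ := fun k => eval x (homogeneousComponent k p)
  have hline (t : ℝ) : eval (t • x) p = ∑ k ∈ Finset.range (d + 1), c k * t ^ k := by
    conv_lhs => rw [← sum_homogeneousComponent p, map_sum]
    exact Finset.sum_congr rfl fun k _ => by
      rw [(homogeneousComponent_isHomogeneous k p).eval_smul, mul_comm]
  have hlim : Tendsto (fun t : ℝ => eval (t • x) p / t ^ d) atTop (𝓝 (c d)) := by
    have h1 : Tendsto (fun t : ℝ => ∑ k ∈ Finset.range d, c k * (t ^ k / t ^ d) + c d) atTop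
        (𝓝 (∑ k ∈ Finset.range d, c k * 0 + c d)) := by
      refine (tendsto_finsetSum _ fun k hk => Tendsto.const_mul _ ?_).add_const _
      exact tendsto_pow_div_pow_atTop_zero (Finset.mem_range.1 hk)
    simp only [mul_zero, Finset.sum_const_zero, zero_add] at h1
    refine h1.congr' ?_
    filter_upwards [eventually_gt_atTop 0] with t ht
    have : t ^ d ≠ 0 := by positivity
    rw [hline, Finset.sum_range_succ, add_div, Finset.sum_div, mul_div_cancel_right₀ _ this]
    simp only [mul_div_assoc]
  set X : EuclideanSpace ℝ (Fin n) := WithLp.toLp 2 x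
  have hzero : Tendsto (fun t : ℝ => eval (t • x) p / t ^ d) atTop (𝓝 0) := by
    have h2 : Tendsto (fun t : ℝ => C * (1 + ‖X‖) ^ γ * t ^ (-(d - γ))) atTop
        (𝓝 (C * (1 + ‖X‖) ^ γ * 0)) :=
      (tendsto_rpow_neg_atTop (sub_pos.2 hlt)).const_mul _
    rw [mul_zero] at h2
    refine squeeze_zero_norm' ?_ h2
    filter_upwards [eventually_ge_atTop 1] with t ht
    have ht0 : 0 < t := by linarith
    have hC : 0 ≤ C := by
      have := (abs_nonneg _).trans (h 0)
      simpa using this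
    have h3 : |eval (t • x) p| ≤ C * (1 + ‖t • X‖) ^ γ := h (t • X)
    rw [norm_div, Real.norm_eq_abs, norm_pow, Real.norm_of_nonneg ht0.le,
      div_le_iff₀ (by positivity)]
    calc _ ≤ C * (1 + ‖t • X‖) ^ γ := h3
      _ ≤ C * ((1 + ‖X‖) * t) ^ γ := by
        gcongr
        rw [norm_smul, Real.norm_of_nonneg ht0.le]
        linarith
      _ = _ := by
        rw [Real.mul_rpow (by positivity) ht0.le, mul_assoc, mul_assoc,
          ← Real.rpow_natCast t d, ← Real.rpow_add ht0]
        congr 3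
        ring
  exact hx (tendsto_nhds_unique hlim hzero)

/-- Polynomials of bounded degree form a finite-dimensional space, which is therefore closed under
pointwise convergence on any set. -/
theorem MvPolynomial.exists_eval_eq_of_tendsto {σ : Type*} [Finite σ] {N : ℕ}
    {p : ℕ → MvPolynomial σ ℝ} (hp : ∀ k, (p k).totalDegree ≤ N) {S : Set (σ → ℝ)}
    {u : (σ → ℝ) → ℝ}
    (hu : ∀ x ∈ S, Tendsto (fun k => eval x (p k)) atTop (𝓝 (u x))) :
    ∃ q : MvPolynomial σ ℝ, q.totalDegree ≤ N ∧ ∀ x ∈ S, u x = eval x q := by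
  let L : MvPolynomial σ ℝ →ₗ[ℝ] (S → ℝ) :=
    LinearMap.pi fun x => (aeval (R := ℝ) (x : σ → ℝ)).toLinearMap
  have hL (q : MvPolynomial σ ℝ) (x : S) : L q x = eval (x : σ → ℝ) q := by
    simp [L, aeval_eq_eval]
  have hclosed : IsClosed ((restrictTotalDegree σ ℝ N).map L : Set (S → ℝ)) :=
    Submodule.closed_of_finiteDimensional _
  have hmem : (fun x : S => u x) ∈ ((restrictTotalDegree σ ℝ N).map L : Set (S → ℝ)) := by
    refine hclosed.mem_of_tendsto (f := fun k => L (p k)) (b := atTop) ?_ (.of_forall fun k =>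
      Submodule.mem_map_of_mem ((mem_restrictTotalDegree _ _ _).2 (hp k)))
    rw [tendsto_pi_nhds]
    intro x
    simpa only [hL] using hu x x.2
  obtain ⟨q, hq, hqu⟩ := hmem
  exact ⟨q, (mem_restrictTotalDegree _ _ _).1 hq, fun x hx => by
    rw [← hL q ⟨x, hx⟩, hqu]⟩

end Polynomials

/-! ### Smooth solutions of polynomial growth -/

section SmoothLiouville

open Filter Topology

variable {n : ℕ} {A : Matrix (Fin n) (Fin n) ℝ} {v : EuclideanSpace ℝ (Fin n) → ℝ}

/-- The square of `v` has integral `O(Rˢ)` over the ball of radius `R`, as `R → ∞`. -/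
def HasSqGrowth (s : ℝ) (v : EuclideanSpace ℝ (Fin n) → ℝ) : Prop :=
  ∃ K : ℝ, ∀ R : ℝ, 1 ≤ R → ∫ x in Metric.closedBall 0 R, v x ^ 2 ≤ K * R ^ s

theorem HasSqGrowth.eq_zero {s : ℝ} (hv : Continuous v) (h : HasSqGrowth s v) (hs : s < 0) :
    v = 0 := by
  obtain ⟨K, hK⟩ := h
  have hint (r : ℝ) : IntegrableOn (fun x => v x ^ 2) (Metric.closedBall 0 r) :=
    (hv.pow 2).continuousOn.integrableOn_compact (isCompact_closedBall _ _)
  have hzero (r : ℝ) : ∫ x in Metric.closedBall 0 r, v x ^ 2 = 0 := by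
    refine le_antisymm ?_ (integral_nonneg fun x => sq_nonneg _)
    have hlim : Tendsto (fun R : ℝ => K * R ^ s) atTop (𝓝 (K * 0)) := by
      have := tendsto_rpow_neg_atTop (neg_pos.2 hs)
      rw [neg_neg] at this
      exact this.const_mul K
    rw [mul_zero] at hlim
    refine ge_of_tendsto hlim ?_
    filter_upwards [eventually_ge_atTop 1, eventually_ge_atTop r] with R hR1 hRr
    exact (setIntegral_mono_set (hint R) (.of_forall fun x => sq_nonneg _)
      (Metric.closedBall_subset_closedBall hRr).eventuallyLE).trans (hK R hR1)
  have hae (k : ℕ) : ∀ᵐ x, x ∈ Metric.closedBall (0 : EuclideanSpace ℝ (Fin n)) k →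
      v x = 0 := by
    have := (setIntegral_eq_zero_iff_of_nonneg_ae (.of_forall fun x => sq_nonneg _)
      (hint k)).1 (hzero k)
    filter_upwards [(ae_restrict_iff' measurableSet_closedBall).1 this] with x hx hxk
    simpa using hx hxk
  refine (Continuous.ae_eq_iff_eq volume hv continuous_zero).1 ?_
  filter_upwards [ae_all_iff.2 hae] with x hx
  obtain ⟨k, hk⟩ := exists_nat_ge ‖x‖
  exact hx k (by simpa using hk)

theorem HasSqGrowth.partialDeriv {a s : ℝ} (ha : 0 < a)
    (hA : ∀ ξ : EuclideanSpace ℝ (Fin n), a * ‖ξ‖ ^ 2 ≤ ∑ i, (∑ j, A i j * ξ j) * ξ i)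
    (hv : ContDiff ℝ ∞ v) (hsol : ∀ x, divGrad A v x = 0) (h : HasSqGrowth s v) (k : Fin n) :
    HasSqGrowth (s - 2) (partialDeriv k v) := by
  obtain ⟨M, hM0, hM⟩ := exists_caccioppoli A ha hA
  obtain ⟨K, hK⟩ := h
  refine ⟨M * K * 2 ^ s, fun R hR => ?_⟩
  have hR0 : 0 < R := by linarith
  refine (hM v hv hsol k R hR0).trans ?_
  refine (mul_le_mul_of_nonneg_left (hK (2 * R) (by linarith)) (by positivity)).trans_eq ?_
  rw [Real.mul_rpow zero_le_two hR0.le, Real.rpow_sub hR0, Real.rpow_two]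
  field_simp

/-- Each derivative lowers the growth exponent by two, so that after finitely many of them nothing
is left. -/
theorem HasSqGrowth.exists_eval_eq {a : ℝ} (ha : 0 < a)
    (hA : ∀ ξ : EuclideanSpace ℝ (Fin n), a * ‖ξ‖ ^ 2 ≤ ∑ i, (∑ j, A i j * ξ j) * ξ i)
    (m : ℕ) : ∀ {v : EuclideanSpace ℝ (Fin n) → ℝ} {s : ℝ}, ContDiff ℝ ∞ v →
      (∀ x, divGrad A v x = 0) → HasSqGrowth s v → s < 2 * m →
      ∃ p : MvPolynomial (Fin n) ℝ, ∀ x : EuclideanSpace ℝ (Fin n),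
        v x = MvPolynomial.eval (fun i => x i) p := by
  induction m with
  | zero =>
    intro v s hv _ h hs
    refine ⟨0, fun x => ?_⟩
    rw [h.eq_zero hv.continuous (by simpa using hs)]
    simp
  | succ m ih =>
    intro v s hv hsol h hs
    refine exists_eval_eq_of_partialDeriv hv fun i => ?_
    refine ih (hv.partialDeriv i) (fun x => ?_) (h.partialDeriv ha hA hv hsol i) ?_
    · have h0 : divGrad A v = fun _ => 0 := funext hsol
      rw [divGrad_partialDeriv hv, h0]
      simp [_root_.partialDeriv]
    · push_cast at hs
      linarith

theorem hasSqGrowth_of_abs_le {C γ : ℝ} (hγ : 0 ≤ γ) (hv : Continuous v)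
    (h : ∀ x, |v x| ≤ C * (1 + ‖x‖) ^ γ) : HasSqGrowth (2 * γ + n) v := by
  refine ⟨C ^ 2 * (2 ^ γ) ^ 2 *
    volume.real (Metric.closedBall (0 : EuclideanSpace ℝ (Fin n)) 1), fun R hR => ?_⟩
  have hR0 : 0 < R := by linarith
  have hC : 0 ≤ C := by simpa using (abs_nonneg _).trans (h 0)
  have hbound : ∀ x ∈ Metric.closedBall (0 : EuclideanSpace ℝ (Fin n)) R,
      v x ^ 2 ≤ (C * (2 ^ γ * R ^ γ)) ^ 2 := by
    intro x hx
    rw [mem_closedBall_zero_iff] at hx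
    rw [← Real.mul_rpow zero_le_two hR0.le]
    refine sq_le_sq.2 ((h x).trans ((?_ : _ ≤ C * (2 * R) ^ γ).trans (le_abs_self _)))
    gcongr
    linarith
  calc ∫ x in Metric.closedBall 0 R, v x ^ 2
      ≤ ∫ x in Metric.closedBall (0 : EuclideanSpace ℝ (Fin n)) R,
          (C * (2 ^ γ * R ^ γ)) ^ 2 :=
        setIntegral_mono_on
          ((hv.pow 2).continuousOn.integrableOn_compact (isCompact_closedBall _ _))
          (continuousOn_const.integrableOn_compact (isCompact_closedBall _ _))
          measurableSet_closedBall hbound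
    _ = _ := by
        rw [setIntegral_const, Measure.addHaar_real_closedBall' _ _ hR0.le,
          finrank_euclideanSpace_fin, smul_eq_mul, two_mul γ, Real.rpow_add hR0,
          Real.rpow_add hR0, Real.rpow_natCast]
        ring

/-- **Liouville theorem** for smooth solutions. -/
theorem exists_eval_eq_of_divGrad_eq_zero {a C γ : ℝ} (ha : 0 < a)
    (hA : ∀ ξ : EuclideanSpace ℝ (Fin n), a * ‖ξ‖ ^ 2 ≤ ∑ i, (∑ j, A i j * ξ j) * ξ i)
    (hγ : 0 ≤ γ) (hv : ContDiff ℝ ∞ v) (hsol : ∀ x, divGrad A v x = 0)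
    (h : ∀ x, |v x| ≤ C * (1 + ‖x‖) ^ γ) :
    ∃ p : MvPolynomial (Fin n) ℝ, p.totalDegree ≤ ⌊γ⌋₊ ∧ ∀ x : EuclideanSpace ℝ (Fin n),
      v x = MvPolynomial.eval (fun i => x i) p := by
  obtain ⟨m, hm⟩ := exists_nat_gt (2 * γ + n)
  obtain ⟨p, hp⟩ := (hasSqGrowth_of_abs_le hγ hv.continuous h).exists_eval_eq ha hA m hv hsol
    (by have : (0 : ℝ) ≤ m := m.cast_nonneg
        linarith)
  exact ⟨p, Nat.le_floor (p.totalDegree_le_of_growth hγ fun x => hp x ▸ h x), hp⟩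

end SmoothLiouville

/-! ### Mollification -/

section Mollification

open Filter Topology
open scoped Convolution

variable {n : ℕ} {A : Matrix (Fin n) (Fin n) ℝ} {u ρ : EuclideanSpace ℝ (Fin n) → ℝ}

theorem partialDeriv_convolution (hu : LocallyIntegrable u volume) (hρ : IsTestFunction ρ)
    (i : Fin n) :
    partialDeriv i (u ⋆[ContinuousLinearMap.lsmul ℝ ℝ] ρ) =
      u ⋆[ContinuousLinearMap.lsmul ℝ ℝ] partialDeriv i ρ := by
  ext x
  have hρ1 : ContDiff ℝ 1 ρ := hρ.1.of_le (by simp)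
  unfold partialDeriv
  rw [(hρ.2.hasFDerivAt_convolution_right _ hu hρ1 x).fderiv,
    convolution_precompR_apply _ hu (hρ.2.fderiv ℝ) (hρ1.continuous_fderiv one_ne_zero)]

/-- Differentiating a mollification amounts to testing `u` with the translated and reflected
mollifier. -/
theorem divGrad_convolution (hu : LocallyIntegrable u volume) (hρ : IsTestFunction ρ)
    (x : EuclideanSpace ℝ (Fin n)) :
    divGrad A (u ⋆[ContinuousLinearMap.lsmul ℝ ℝ] ρ) x =
      ∫ t, u t * divGrad A (fun t => ρ (x - t)) t := by
  have hint (i j : Fin n) :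
      Integrable fun t => u t * partialDeriv j (partialDeriv i ρ) (x - t) :=
    ((hρ.partialDeriv i).partialDeriv j).2.convolutionExists_right
      (ContinuousLinearMap.lsmul ℝ ℝ) hu ((hρ.partialDeriv i).partialDeriv j).1.continuous x
  simp_rw [divGrad_const_sub_comp hρ.1]
  unfold divGrad
  simp only [Finset.mul_sum, mul_left_comm (u _)]
  rw [integral_sum_sum_const_mul A hint]
  simp_rw [partialDeriv_convolution hu hρ, partialDeriv_convolution hu (hρ.partialDeriv _)]
  rfl

/-- Mollification at scale at most one preserves polynomial growth, with a constant that does not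
depend on the mollifier. -/
theorem abs_convolution_normed_le {C γ : ℝ} (hC : 0 ≤ C) (hγ : 0 ≤ γ)
    (hu : ∀ᵐ x, |u x| ≤ C * (1 + ‖x‖) ^ γ)
    (ρ : ContDiffBump (0 : EuclideanSpace ℝ (Fin n))) (hρ : ρ.rOut ≤ 1)
    (x : EuclideanSpace ℝ (Fin n)) :
    |(u ⋆[ContinuousLinearMap.lsmul ℝ ℝ] ρ.normed volume) x| ≤
      C * 2 ^ γ * (1 + ‖x‖) ^ γ := by
  have hint : Integrable fun t => C * 2 ^ γ * (1 + ‖x‖) ^ γ * ρ.normed volume (x - t) :=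
    (ρ.integrable_normed.comp_sub_left x).const_mul _
  have hle : ‖∫ t, u t * ρ.normed volume (x - t)‖ ≤
      ∫ t, C * 2 ^ γ * (1 + ‖x‖) ^ γ * ρ.normed volume (x - t) := by
    refine norm_integral_le_of_norm_le hint ?_
    filter_upwards [hu] with t ht
    rw [norm_mul, Real.norm_of_nonneg (ρ.nonneg_normed _), Real.norm_eq_abs]
    by_cases hxt : x - t ∈ Metric.ball 0 ρ.rOut
    · refine mul_le_mul_of_nonneg_right (ht.trans ?_) (ρ.nonneg_normed _)
      rw [mul_assoc, ← Real.mul_rpow zero_le_two (by positivity)]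
      have h1 : ‖x - t‖ ≤ 1 := (mem_ball_zero_iff.1 hxt).le.trans hρ
      have h2 : ‖t‖ ≤ ‖x‖ + ‖x - t‖ := by
        simpa using norm_sub_le x (x - t)
      have h3 := norm_nonneg x
      gcongr
      linarith
    · rw [← ρ.support_normed_eq (μ := volume), Function.notMem_support] at hxt
      simp [hxt]
  rwa [integral_const_mul, integral_sub_left_eq_self (ρ.normed volume) volume x,
    ρ.integral_normed, mul_one] at hle

end Mollification

/-! ### Weak solutions -/

section WeakSolutions

open Filter Topology
open scoped Convolution

variable {n : ℕ} {A : Matrix (Fin n) (Fin n) ℝ} {u : EuclideanSpace ℝ (Fin n) → ℝ}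

/-- Weak solutions are solutions in the sense of distributions. -/
theorem IsEntireSolution.integral_mul_divGrad_eq_zero (hu : IsEntireSolution A u)
    {φ : EuclideanSpace ℝ (Fin n) → ℝ} (hφ : IsTestFunction φ) :
    ∫ x, u x * divGrad A φ x = 0 := by
  obtain ⟨⟨-, g, hg, -⟩, hsol⟩ := hu
  have hgj (j : Fin n) : LocallyIntegrable (fun x => g x j) volume := fun x =>
    (hg.locallyIntegrable_grad x).imp fun s hs =>
      ⟨hs.1, (EuclideanSpace.proj (𝕜 := ℝ) j).integrable_comp hs.2⟩
  have h1 (i j : Fin n) : Integrable fun x => u x * partialDeriv j (partialDeriv i φ) x :=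
    hg.locallyIntegrable.integrable_smul_right_of_hasCompactSupport
      ((hφ.partialDeriv i).partialDeriv j).1.continuous ((hφ.partialDeriv i).partialDeriv j).2
  have h2 (i j : Fin n) : Integrable fun x => g x j * partialDeriv i φ x :=
    (hgj j).integrable_smul_right_of_hasCompactSupport
      (hφ.partialDeriv i).1.continuous (hφ.partialDeriv i).2
  have e := hsol g hg φ hφ
  simp only [Finset.sum_mul, mul_assoc] at e
  rw [integral_sum_sum_const_mul A h2] at e
  simp only [divGrad, Finset.mul_sum, mul_left_comm (u _)]
  rw [integral_sum_sum_const_mul A h1, ← neg_zero, ← e, ← Finset.sum_neg_distrib]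
  refine Finset.sum_congr rfl fun i _ => ?_
  rw [← Finset.sum_neg_distrib]
  refine Finset.sum_congr rfl fun j _ => ?_
  rw [hg.integral_eq _ (hφ.partialDeriv i) j, mul_neg]

theorem IsEntireHarmonic.isEntireSolution_one (hu : IsEntireHarmonic u) :
    IsEntireSolution (1 : Matrix (Fin n) (Fin n) ℝ) u := by
  refine ⟨hu.1, fun g hg φ hφ => ?_⟩
  simpa [Matrix.one_apply] using hu.2 g hg φ hφ

theorem isUniformlyElliptic_one : IsUniformlyElliptic (1 : Matrix (Fin n) (Fin n) ℝ) := by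
  refine ⟨1, 1, one_pos, le_rfl, fun ξ => ?_⟩
  have : ∑ i, (∑ j, (1 : Matrix (Fin n) (Fin n) ℝ) i j * ξ j) * ξ i = ‖ξ‖ ^ 2 := by
    rw [EuclideanSpace.real_norm_sq_eq]
    simp [Matrix.one_apply, sq]
  rw [this, one_mul]
  exact ⟨le_rfl, le_rfl⟩

/-- **Liouville theorem** for weak solutions with constant coefficients. -/
theorem IsEntireSolution.exists_eval_ae_eq {C γ : ℝ} (hC : 0 ≤ C) (hγ : 0 ≤ γ)
    (hu : ∀ᵐ x, |u x| ≤ C * (1 + ‖x‖) ^ γ) (hA : IsUniformlyElliptic A)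
    (hsol : IsEntireSolution A u) :
    ∃ p : MvPolynomial (Fin n) ℝ, p.totalDegree ≤ ⌊γ⌋₊ ∧
      ∀ᵐ x : EuclideanSpace ℝ (Fin n), u x = MvPolynomial.eval (fun i => x i) p := by
  obtain ⟨a, b, ha, -, hab⟩ := hA
  have huloc : LocallyIntegrable u volume := by
    obtain ⟨⟨-, g, hg, -⟩, -⟩ := hsol
    exact hg.locallyIntegrable
  let ρ : ℕ → ContDiffBump (0 : EuclideanSpace ℝ (Fin n)) := fun k =>
    ⟨1 / (k + 1) / 2, 1 / (k + 1), by positivity, half_lt_self (by positivity)⟩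
  have hρ (k : ℕ) : IsTestFunction ((ρ k).normed volume) :=
    ⟨(ρ k).contDiff_normed, (ρ k).hasCompactSupport_normed⟩
  have hpoly (k : ℕ) := exists_eval_eq_of_divGrad_eq_zero
    (v := u ⋆[ContinuousLinearMap.lsmul ℝ ℝ] (ρ k).normed volume) ha (fun ξ => (hab ξ).1) hγ
    ((hρ k).2.contDiff_convolution_right _ huloc (hρ k).1)
    (fun x => by
      rw [divGrad_convolution huloc (hρ k)]
      exact hsol.integral_mul_divGrad_eq_zero ⟨(hρ k).1.comp (contDiff_const.sub contDiff_id),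
        (hρ k).2.comp_homeomorph (Homeomorph.subLeft x)⟩)
    (abs_convolution_normed_le hC hγ hu (ρ k) (by
      change 1 / ((k : ℝ) + 1) ≤ 1
      rw [div_le_one (by positivity)]
      simp))
  choose p hp hpv using hpoly
  have hlim : ∀ᵐ x : EuclideanSpace ℝ (Fin n),
      Tendsto (fun k => MvPolynomial.eval (fun i => x i) (p k)) atTop (𝓝 (u x)) := by
    have := ContDiffBump.ae_convolution_tendsto_right_of_locallyIntegrable (φ := ρ) (K := 2)
      (l := atTop) tendsto_one_div_add_atTop_nhds_zero_nat
      (.of_forall fun k => by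
        change 1 / ((k : ℝ) + 1) ≤ 2 * (1 / (k + 1) / 2)
        linarith) huloc
    filter_upwards [this] with x hx
    refine hx.congr fun k => ?_
    rw [← hpv, convolution_lsmul_swap]
    simp only [convolution_def, ContinuousLinearMap.lsmul_apply, smul_eq_mul, mul_comm]
  obtain ⟨q, hq, hqu⟩ := MvPolynomial.exists_eval_eq_of_tendsto hp
    (S := {y | Tendsto (fun k => MvPolynomial.eval y (p k)) atTop (𝓝 (u (WithLp.toLp 2 y)))})
    (u := fun y => u (WithLp.toLp 2 y)) fun x hx => hx
  refine ⟨q, hq, ?_⟩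
  filter_upwards [hlim] with x hx
  exact hqu (fun i => x i) hx

end WeakSolutions

theorem mainTheorem7 (n : ℕ) (u : EuclideanSpace ℝ (Fin n) → ℝ) (C γ : ℝ) (hC : 0 < C)
    (hγ : 0 ≤ γ) (hu : ∀ᵐ x ∂(volume : Measure (EuclideanSpace ℝ (Fin n))),
      |u x| ≤ C * (1 + ‖x‖) ^ γ) :
    (IsEntireHarmonic u →
      ∃ p : MvPolynomial (Fin n) ℝ, (p.totalDegree : ℤ) ≤ ⌊γ⌋ ∧
        ∀ᵐ x ∂(volume : Measure (EuclideanSpace ℝ (Fin n))),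
          u x = MvPolynomial.eval (fun i => x i) p) ∧
    (∀ A : Matrix (Fin n) (Fin n) ℝ, IsUniformlyElliptic A → IsEntireSolution A u →
      ∃ p : MvPolynomial (Fin n) ℝ, (p.totalDegree : ℤ) ≤ ⌊γ⌋ ∧
        ∀ᵐ x ∂(volume : Measure (EuclideanSpace ℝ (Fin n))),
          u x = MvPolynomial.eval (fun i => x i) p) := by
  have key (A : Matrix (Fin n) (Fin n) ℝ) (hA : IsUniformlyElliptic A)
      (hsol : IsEntireSolution A u) : ∃ p : MvPolynomial (Fin n) ℝ,
      (p.totalDegree : ℤ) ≤ ⌊γ⌋ ∧ ∀ᵐ x ∂(volume : Measure (EuclideanSpace ℝ (Fin n))),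
        u x = MvPolynomial.eval (fun i => x i) p := by
    obtain ⟨p, hp, hpu⟩ := hsol.exists_eval_ae_eq hC.le hγ hu hA
    refine ⟨p, ?_, hpu⟩
    rw [← Int.natCast_floor_eq_floor hγ]
    exact_mod_cast hp
  exact ⟨fun h => key 1 isUniformlyElliptic_one h.isEntireSolution_one, key⟩
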